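/- Let $c\ge 0$ and $\kappa\in\mathbb{R}$ satisfy $(c,\kappa)\in\tilde{\mathcal D}\cup\mathcal C$, where $$\tilde{\mathcal D}=\{0\le c<\sqrt2,\ 0<\kappa<\tfrac12\}\cup\{c>\sqrt2,\ \kappa>\tfrac12\}\cup\{c=\sqrt2,\ 0<\kappa<\tfrac12\}\cup\{c=\sqrt2,\ \kappa>\tfrac12\},\qquad \mathcal C=\{c\ge0,\ \kappa=\tfrac12\}.$$ Let $$\mathcal X(\mathbb R)=\{v\in H^1_{\mathrm{loc}}(\mathbb R;\mathbb C):\ 1-|v|^2\in L^2(\mathbb R),\ v'\in L^2(\mathbb R)\},\qquad \mathcal{NX}(\mathbb R)=\{v\in\mathcal X(\mathbb R):\ \inf_{\mathbb R}|v|>0\},$$ where every element of $\mathcal X(\mathbb R)$ is identified with its continuous representative (which exists). Let $u\in\mathcal X(\mathbb R)$ be a weak solution of $$icu'+u''+u(1-|u|^2)+\kappa u(1-|u|^2)''=0\quad\text{in }\mathbb R,$$ that is, with $\langle z_1,z_2\rangle=\operatorname{Re}(z_1\bar z_2)$, for all $\phi\in\mathcal C_0^\infty(\mathbb R;\mathbb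 C)$, $$\int_{\mathbb R}\langle icu'+u(1-|u|^2),\phi\rangle-\langle u',\phi'\rangle+2\kappa\langle u,u'\rangle\langle u,\phi\rangle'=0 .$$ If $c>0$, then $u\in\mathcal{NX}(\mathbb R)$. If $c=0$, then there exists $\phi\in\mathbb R$ such that $e^{i\phi}u(x)\in\mathbb R$ for all $x\in\mathbb R$. -/

import Mathlib

open MeasureTheory

open scoped ContDiff

noncomputable section

namespace QGP

/-- The parameter region `0 ≤ c < √2`, `0 < κ < 1/2`. -/
def regionD1 : Set (ℝ × ℝ) :=
  {p | 0 ≤ p.1 ∧ p.1 < Real.sqrt 2 ∧ 0 < p.2 ∧ p.2 < 1 / 2}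

/-- The parameter region `c > √2`, `κ > 1/2`. -/
def regionD3 : Set (ℝ × ℝ) :=
  {p | Real.sqrt 2 < p.1 ∧ 1 / 2 < p.2}

/-- The sonic boundary `c = √2`, `0 < κ < 1/2`. -/
def boundaryBminus : Set (ℝ × ℝ) :=
  {p | p.1 = Real.sqrt 2 ∧ 0 < p.2 ∧ p.2 < 1 / 2}

/-- The sonic boundary `c = √2`, `κ > 1/2`. -/
def boundaryBplus : Set (ℝ × ℝ) :=
  {p | p.1 = Real.sqrt 2 ∧ 1 / 2 < p.2}

/-- The critical set `c ≥ 0`, `κ = 1/2`. -/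
def criticalC : Set (ℝ × ℝ) :=
  {p | 0 ≤ p.1 ∧ p.2 = 1 / 2}

/-- The set `𝒟̃ = 𝒟₁ ∪ 𝒟₃ ∪ ℬ₋ ∪ ℬ₊`. -/
def regionDtilde : Set (ℝ × ℝ) :=
  regionD1 ∪ regionD3 ∪ boundaryBminus ∪ boundaryBplus

/-- `f ∈ L²_loc(ℝ; ℂ)`. -/
def MemL2Loc (f : ℝ → ℂ) : Prop :=
  ∀ K : Set ℝ, IsCompact K → MemLp f 2 (volume.restrict K)

/-- `v` is a weak (distributional) derivative of `u` on `ℝ`. -/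
def HasWeakDeriv (u v : ℝ → ℂ) : Prop :=
  LocallyIntegrable u volume ∧ LocallyIntegrable v volume ∧
    ∀ φ : ℝ → ℝ, ContDiff ℝ ∞ φ → HasCompactSupport φ →
      ∫ x, deriv φ x • u x = - ∫ x, φ x • v x

/-- `u ∈ H¹_loc(ℝ; ℂ)`. -/
def MemH1Loc (u : ℝ → ℂ) : Prop :=
  MemL2Loc u ∧ ∃ v : ℝ → ℂ, MemL2Loc v ∧ HasWeakDeriv u v

/-- The energy space: `u ∈ H¹_loc(ℝ)`, `1 - |u|² ∈ L²(ℝ)` and `u' ∈ L²(ℝ)`. -/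
def MemX (u : ℝ → ℂ) : Prop :=
  MemH1Loc u ∧ MemLp (fun x => 1 - ‖u x‖ ^ 2) 2 volume ∧
    ∃ v : ℝ → ℂ, HasWeakDeriv u v ∧ MemLp v 2 volume

/-- The nonvanishing energy space: `u` lies in the energy space and `inf_ℝ |u| > 0`.
The infimum is pointwise, so `u` is meant to be the continuous representative of its class. -/
def MemNX (u : ℝ → ℂ) : Prop :=
  MemX u ∧ 0 < ⨅ x : ℝ, ‖u x‖

/-- `u` is a weak solution of `i c u' + u'' + u (1 - |u|²) + κ u (1 - |u|²)'' = 0`; here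
`v = u'` is the weak derivative (unique almost everywhere), `inner ℝ` is the real scalar product
`Re (z₁ * conj z₂)` of `ℂ`, and `⟨v, φ⟩ + ⟨u, φ'⟩` is the derivative of `⟨u, φ⟩`. All the
integrands are integrable for `u ∈ H¹_loc(ℝ)`. -/
def IsWeakSolution (c κ : ℝ) (u : ℝ → ℂ) : Prop :=
  MemH1Loc u ∧ ∃ v : ℝ → ℂ, MemL2Loc v ∧ HasWeakDeriv u v ∧
    ∀ φ : ℝ → ℂ, ContDiff ℝ ∞ φ → HasCompactSupport φ →
      ∫ x, (inner ℝ (Complex.I * c * v x + u x * ((1 - ‖u x‖ ^ 2 : ℝ) : ℂ)) (φ x)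
        - inner ℝ (v x) (deriv φ x)
        + 2 * κ * inner ℝ (u x) (v x)
          * (inner ℝ (v x) (φ x) + inner ℝ (u x) (deriv φ x))) = 0

end QGP

end

open MeasureTheory Filter Topology

open scoped ContDiff

noncomputable section

/-! Write the equation as P' = -S, with flux P = u' - 2κ⟨u,u'⟩u and S the `source`. Thus P is
absolutely continuous, and no division by 1 - 2κ|u|², the coefficient at which u'' degenerates, is
needed. Since P - u' is a real multiple of u, u × P = ⟨iu,u'⟩, and (u × P)' = -(c/2)(|u|²)'. Hence u
× P - (c/2)(1 - |u|²) is constant; it lies in L²(ℝ), so it vanishes (`momentum_eq`).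

For c > 0, a zero of u would give 0 = c/2; as |u| → 1 at infinity, |u| is bounded below. For c = 0,
u and P are parallel everywhere. With e = u(x₀) ≠ 0, the pair (e × u, e × P) solves a linear
first-order system with locally integrable coefficients and zero data at x₀, so Grönwall uniqueness
gives e × u = 0 (`parallel_of_speed_eq_zero`). -/

/-! ### Calculus of absolutely continuous functions -/

/-- `f` is the indefinite integral of the locally integrable function `f'`. -/
structure IsPrimitive (f f' : ℝ → ℝ) : Prop where
  locallyIntegrable : LocallyIntegrable f' volume
  integral_eq : ∀ a b, ∫ x in a..b, f' x = f b - f a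

namespace IsPrimitive

variable {f f' g g' : ℝ → ℝ}

theorem intervalIntegrable (hf : IsPrimitive f f') (a b : ℝ) :
    IntervalIntegrable f' volume a b :=
  (hf.locallyIntegrable.integrableOn_isCompact isCompact_uIcc).intervalIntegrable

theorem eq_add (hf : IsPrimitive f f') (a x : ℝ) : f x = f a + ∫ t in a..x, f' t := by
  rw [hf.integral_eq]; ring

theorem continuous (hf : IsPrimitive f f') : Continuous f := by
  have h : f = fun x => f 0 + ∫ t in (0 : ℝ)..x, f' t := funext fun x => hf.eq_add 0 x
  rw [h]
  exact continuous_const.add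
    (intervalIntegral.continuous_primitive (fun a b => hf.intervalIntegrable a b) 0)

theorem absolutelyContinuousOnInterval (hf : IsPrimitive f f') (a b : ℝ) :
    AbsolutelyContinuousOnInterval f a b := by
  have h : f = (fun _ => f a) + fun x => ∫ t in a..x, f' t := funext fun x => hf.eq_add a x
  rw [h]
  exact (contDiff_const.contDiffOn.absolutelyContinuousOnInterval).add
    ((hf.intervalIntegrable a b).absolutelyContinuousOnInterval_intervalIntegral (by simp))

theorem ae_hasDerivAt (hf : IsPrimitive f f') : ∀ᵐ x, HasDerivAt f (f' x) x := by
  filter_upwards [LocallyIntegrable.ae_hasDerivAt_integral hf.locallyIntegrable] with x hx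
  have h : f = fun x => f 0 + ∫ t in (0 : ℝ)..x, f' t := funext fun x => hf.eq_add 0 x
  rw [h]
  exact (hx 0).const_add _

theorem of_ae_eq (hf : IsPrimitive f f') (h : f' =ᵐ[volume] g') : IsPrimitive f g' where
  locallyIntegrable := hf.locallyIntegrable.congr h
  integral_eq a b := by
    rw [← hf.integral_eq a b]
    exact intervalIntegral.integral_congr_ae (h.mono fun x hx _ => hx.symm)

theorem add (hf : IsPrimitive f f') (hg : IsPrimitive g g') :
    IsPrimitive (fun x => f x + g x) (fun x => f' x + g' x) where
  locallyIntegrable := hf.locallyIntegrable.add hg.locallyIntegrable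
  integral_eq a b := by
    rw [intervalIntegral.integral_add (hf.intervalIntegrable a b) (hg.intervalIntegrable a b),
      hf.integral_eq, hg.integral_eq]; ring

theorem const_mul (hf : IsPrimitive f f') (r : ℝ) :
    IsPrimitive (fun x => r * f x) (fun x => r * f' x) where
  locallyIntegrable := hf.locallyIntegrable.smul r
  integral_eq a b := by
    rw [intervalIntegral.integral_const_mul, hf.integral_eq]; ring

theorem sub (hf : IsPrimitive f f') (hg : IsPrimitive g g') :
    IsPrimitive (fun x => f x - g x) (fun x => f' x - g' x) := by
  simpa [sub_eq_add_neg] using hf.add (hg.const_mul (-1))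

theorem mul (hf : IsPrimitive f f') (hg : IsPrimitive g g') :
    IsPrimitive (fun x => f x * g x) (fun x => f' x * g x + f x * g' x) where
  locallyIntegrable := by
    refine LocallyIntegrable.add ?_ ?_
    · simpa [mul_comm] using hf.locallyIntegrable.continuous_smul hg.continuous
    · simpa using hg.locallyIntegrable.continuous_smul hf.continuous
  integral_eq a b := by
    rw [← (hf.absolutelyContinuousOnInterval a b).integral_deriv_mul_eq_sub
      (hg.absolutelyContinuousOnInterval a b)]
    refine intervalIntegral.integral_congr_ae ?_
    filter_upwards [hf.ae_hasDerivAt, hg.ae_hasDerivAt] with x h1 h2 _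
    rw [h1.deriv, h2.deriv]

theorem of_contDiff (hf : ContDiff ℝ 1 f) : IsPrimitive f (deriv f) where
  locallyIntegrable := (hf.continuous_deriv le_rfl).locallyIntegrable
  integral_eq a b := intervalIntegral.integral_deriv_eq_sub
    (fun x _ => (hf.differentiable one_ne_zero) x)
    ((hf.continuous_deriv le_rfl).intervalIntegrable a b)

theorem eq_const_of_ae_zero (hf : IsPrimitive f f') (h : f' =ᵐ[volume] 0) (x : ℝ) :
    f x = f 0 := by
  have := (hf.of_ae_eq h).integral_eq 0 x
  simp at this
  linarith

theorem integral_eq_zero_of_hasCompactSupport (hf : IsPrimitive f f')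
    (hs : HasCompactSupport f) (hs' : HasCompactSupport f') : ∫ x, f' x = 0 := by
  obtain ⟨R, hR⟩ := ((hs.isBounded.union hs'.isBounded).subset_closedBall 0)
  have hz : ∀ x, R < |x| → f x = 0 ∧ f' x = 0 := by
    intro x hx
    have : x ∉ tsupport f ∪ tsupport f' := fun h => by
      have := hR h
      simp at this
      linarith
    simp only [Set.mem_union, not_or] at this
    exact ⟨image_eq_zero_of_notMem_tsupport this.1, image_eq_zero_of_notMem_tsupport this.2⟩
  -- R may be negative; this S is positive and ±S lie outside both supports.
  set S := |R| + 1
  have hS : R < S := (le_abs_self R).trans_lt (lt_add_one _)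
  have hS0 : 0 < S := by positivity
  have h := hf.integral_eq (-S) S
  rw [(hz S (by rwa [abs_of_pos hS0])).1,
    (hz (-S) (by rwa [abs_neg, abs_of_pos hS0])).1, sub_zero] at h
  rw [← h, eq_comm]
  refine intervalIntegral.integral_eq_integral_of_support_subset fun x hx => ?_
  by_contra hx'
  refine hx (hz x ?_).2
  by_contra! hle
  obtain ⟨h1, h2⟩ := abs_le.1 (hle.trans hS.le)
  rcases h1.lt_or_eq with h1 | h1
  · exact hx' ⟨h1, h2⟩
  · rw [← h1, abs_neg, abs_of_pos hS0] at hle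
    linarith

/-- Integration by parts against a test function. -/
theorem integral_deriv_mul (hf : IsPrimitive f f') {φ : ℝ → ℝ} (hφ : ContDiff ℝ 1 φ)
    (hs : HasCompactSupport φ) : ∫ x, deriv φ x * f x = - ∫ x, φ x * f' x := by
  have h := ((of_contDiff hφ).mul hf).integral_eq_zero_of_hasCompactSupport
    (hs.mul_right) (hs.deriv.mul_right.add hs.mul_right)
  rw [integral_add] at h
  · linarith
  · exact ((hφ.continuous_deriv le_rfl).mul hf.continuous).integrable_of_hasCompactSupport
      hs.deriv.mul_right
  · exact hf.locallyIntegrable.integrable_smul_left_of_hasCompactSupport hφ.continuous hs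

end IsPrimitive

/-! ### Distributional derivatives on the line -/

/-- The du Bois-Reymond lemma: a locally integrable function whose distributional derivative
vanishes is almost everywhere constant. -/
theorem ae_eq_const_of_integral_deriv_mul_eq_zero {h : ℝ → ℝ} (hh : LocallyIntegrable h volume)
    (H : ∀ φ : ℝ → ℝ, ContDiff ℝ ∞ φ → HasCompactSupport φ → ∫ x, deriv φ x * h x = 0) :
    ∃ C : ℝ, h =ᵐ[volume] fun _ => C := by
  let b : ContDiffBump (0 : ℝ) := ⟨1, 2, one_pos, one_lt_two⟩
  set ψ : ℝ → ℝ := b.normed volume with hψ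
  have ψs : ContDiff ℝ ∞ ψ := b.contDiff_normed
  have ψc : HasCompactSupport ψ := b.hasCompactSupport_normed
  have ψi : ∫ x, ψ x = 1 := b.integral_normed
  have int_mul : ∀ {φ k : ℝ → ℝ}, ContDiff ℝ ∞ φ → HasCompactSupport φ →
      LocallyIntegrable k volume → Integrable (fun x => φ x * k x) volume := fun h1 h2 h3 =>
    h3.integrable_smul_left_of_hasCompactSupport h1.continuous h2
  refine ⟨∫ x, ψ x * h x, ?_⟩
  refine ae_eq_of_integral_contDiff_smul_eq hh (locallyIntegrable_const _) fun φ hφ hφc => ?_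
  -- Subtracting m times the unit-mass bump ψ leaves a mean-zero θ, whose primitive has compact
  -- support and is therefore an admissible test function.
  set m := ∫ x, φ x with hm
  set θ : ℝ → ℝ := fun x => φ x - m * ψ x with hθ
  have θs : ContDiff ℝ ∞ θ := hφ.sub (contDiff_const.mul ψs)
  have θc : HasCompactSupport θ := hφc.sub ψc.mul_left
  have θi : ∫ x, θ x = 0 := by
    rw [hθ, integral_sub (hφ.continuous.integrable_of_hasCompactSupport hφc)
      ((ψs.continuous.integrable_of_hasCompactSupport ψc).const_mul _), integral_const_mul, ψi]
    simp [hm]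
  obtain ⟨R, hR⟩ := θc.isBounded.subset_closedBall 0
  have hz : ∀ x, R < |x| → θ x = 0 := by
    intro x hx
    refine image_eq_zero_of_notMem_tsupport fun h => ?_
    have := hR h
    simp at this
    linarith
  set S := |R| + 1 with hSdef
  have hS : R < S := (le_abs_self R).trans_lt (lt_add_one _)
  have hS0 : 0 < S := by positivity
  set Φ : ℝ → ℝ := fun x => ∫ t in (-S)..x, θ t with hΦ
  have Φd : ∀ x, HasDerivAt Φ (θ x) x := fun x =>
    intervalIntegral.integral_hasDerivAt_right (θs.continuous.intervalIntegrable _ _)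
      θs.continuous.stronglyMeasurable.stronglyMeasurableAtFilter θs.continuous.continuousAt
  have dΦ : deriv Φ = θ := funext fun x => (Φd x).deriv
  have Φs : ContDiff ℝ ∞ Φ :=
    contDiff_infty_iff_deriv.2 ⟨fun x => (Φd x).differentiableAt, by rwa [dΦ]⟩
  have Φc : HasCompactSupport Φ := by
    refine HasCompactSupport.intro (isCompact_Icc (a := -S) (b := S)) fun x hx => ?_
    rw [Set.mem_Icc, not_and_or, not_le, not_le] at hx
    rcases hx with hx | hx
    · refine intervalIntegral.integral_zero_ae (Filter.Eventually.of_forall fun t ht => ?_)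
      rw [Set.uIoc_of_ge hx.le] at ht
      refine hz t ?_
      rw [abs_of_nonpos (by linarith [ht.2])]
      rcases ht.2.lt_or_eq with h | h <;> linarith
    · rw [← θi]
      refine intervalIntegral.integral_eq_integral_of_support_subset fun t ht => ?_
      have : |t| ≤ R := not_lt.1 fun h => ht (hz t h)
      obtain ⟨h1, h2⟩ := abs_le.1 this
      exact ⟨by linarith, by linarith⟩
  have key := H Φ Φs Φc
  rw [dΦ] at key
  have h1 : (fun x => θ x * h x) = fun x => φ x * h x - m * (ψ x * h x) := by
    funext x; simp only [hθ]; ring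
  rw [h1, integral_sub (int_mul hφ hφc hh) ((int_mul ψs ψc hh).const_mul _),
    integral_const_mul] at key
  simp only [smul_eq_mul]
  rw [integral_mul_const, ← hm]
  linarith

/-- A locally integrable function with a locally integrable distributional derivative
has an absolutely continuous representative. -/
theorem exists_isPrimitive {f g : ℝ → ℝ} (hf : LocallyIntegrable f volume)
    (hg : LocallyIntegrable g volume)
    (H : ∀ φ : ℝ → ℝ, ContDiff ℝ ∞ φ → HasCompactSupport φ →
      ∫ x, deriv φ x * f x = - ∫ x, φ x * g x) :
    ∃ w, IsPrimitive w g ∧ w =ᵐ[volume] f := by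
  have ii : ∀ a b, IntervalIntegrable g volume a b := fun a b =>
    (hg.integrableOn_isCompact isCompact_uIcc).intervalIntegrable
  have hG : ∀ C : ℝ, IsPrimitive (fun x => C + ∫ t in (0 : ℝ)..x, g t) g := fun C =>
    ⟨hg, fun a b => by
      rw [add_sub_add_left_eq_sub, intervalIntegral.integral_interval_sub_left (ii _ _) (ii _ _)]⟩
  have hc := (hG 0).continuous
  obtain ⟨C, hC⟩ := ae_eq_const_of_integral_deriv_mul_eq_zero
    (hf.sub hc.locallyIntegrable) (fun φ hφ hφc => by
      have dc : Continuous (deriv φ) := hφ.continuous_deriv (by simp)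
      have h1 := (hG 0).integral_deriv_mul (hφ.of_le (by simp)) hφc
      have h2 := H φ hφ hφc
      simp only [Pi.sub_apply, mul_sub]
      rw [integral_sub, h1, h2, sub_self]
      · exact hf.integrable_smul_left_of_hasCompactSupport dc hφc.deriv
      · exact (dc.mul hc).integrable_of_hasCompactSupport hφc.deriv.mul_right)
  refine ⟨_, hG C, hC.mono fun x hx => ?_⟩
  simp only [Pi.sub_apply, zero_add] at hx
  linarith

/-! ### Uniqueness for linear systems with locally integrable coefficients -/

/-- Grönwall uniqueness with a locally integrable coefficient, for a pair of functions. -/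
theorem eq_zero_of_isPrimitive_of_abs_le {y q y' q' a : ℝ → ℝ} (hy : IsPrimitive y y')
    (hq : IsPrimitive q q') (ha : LocallyIntegrable a volume)
    (hb : ∀ᵐ x, |y' x| + |q' x| ≤ a x * (|y x| + |q x|)) {x₀ : ℝ}
    (hy₀ : y x₀ = 0) (hq₀ : q x₀ = 0) (x : ℝ) : y x = 0 ∧ q x = 0 := by
  set Z : ℝ → ℝ := fun x => |y x| + |q x| with hZ
  have Zc : Continuous Z := hy.continuous.abs.add hq.continuous.abs
  have Z0 : ∀ x, 0 ≤ Z x := fun x => by positivity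
  have Zz : ∀ x, Z x = 0 ↔ y x = 0 ∧ q x = 0 := fun x => by
    simp only [hZ]
    rw [add_eq_zero_iff_of_nonneg (abs_nonneg _) (abs_nonneg _), abs_eq_zero, abs_eq_zero]
  have ii : ∀ s t, IntervalIntegrable a volume s t := fun s t =>
    (ha.integrableOn_isCompact isCompact_uIcc).intervalIntegrable
  have iabs : ∀ s t, IntervalIntegrable (fun x => |a x|) volume s t := fun s t => (ii s t).abs
  -- Near a zero p of Z the integral of |a| is below 1/2. At a maximum point M of Z on a small ball
  -- this gives Z M ≤ Z M / 2, so Z vanishes on the ball. The zero set is thus clopen.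
  have hopen : IsOpen {x | Z x = 0} := by
    rw [isOpen_iff_mem_nhds]
    intro p hp
    have hp' := (Zz p).1 hp
    have hA : Continuous fun t => ∫ s in p..t, |a s| :=
      intervalIntegral.continuous_primitive iabs p
    have hAp : ∀ᶠ t in nhds p, |(∫ s in p..t, |(a s)|)| < 1 / 2 := by
      have := (hA.abs).tendsto p
      simp only [intervalIntegral.integral_same, abs_zero] at this
      exact this.eventually (gt_mem_nhds (by norm_num))
    obtain ⟨ε, hε, hball⟩ := Metric.eventually_nhds_iff_ball.1 hAp
    refine Filter.mem_of_superset (Metric.closedBall_mem_nhds p (half_pos hε)) fun z hz => ?_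
    obtain ⟨M, hM, hmax⟩ := (isCompact_closedBall p (ε / 2)).exists_isMaxOn
      ⟨p, Metric.mem_closedBall_self (half_pos hε).le⟩ Zc.continuousOn
    have hsub : Set.uIcc p M ⊆ Metric.closedBall p (ε / 2) := by
      rw [Real.closedBall_eq_Icc] at hM ⊢
      exact Set.uIcc_subset_Icc ⟨by linarith, by linarith⟩ hM
    have e1 : y M = ∫ t in p..M, y' t := by rw [hy.integral_eq, hp'.1, sub_zero]
    have e2 : q M = ∫ t in p..M, q' t := by rw [hq.integral_eq, hp'.2, sub_zero]
    have hZM : Z M ≤ |∫ t in p..M, |a t| * Z M| := by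
      have b1 : |y M| ≤ |(∫ t in p..M, |y' t|)| := by
        rw [e1]
        simpa only [Real.norm_eq_abs] using
          intervalIntegral.norm_integral_le_abs_integral_norm (E := ℝ) (μ := volume)
      have b2 : |q M| ≤ |(∫ t in p..M, |q' t|)| := by
        rw [e2]
        simpa only [Real.norm_eq_abs] using
          intervalIntegral.norm_integral_le_abs_integral_norm (E := ℝ) (μ := volume)
      have i1 := (hy.intervalIntegrable p M).abs
      have i2 := (hq.intervalIntegrable p M).abs
      have key : ∀ᵐ t, t ∈ Set.uIoc p M → |y' t| + |q' t| ≤ |a t| * Z M := by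
        filter_upwards [hb] with t ht htm
        have hZt : Z t ≤ Z M := hmax (hsub (Set.uIoc_subset_uIcc htm))
        exact ht.trans (mul_le_mul (le_abs_self _) hZt (Z0 t) (abs_nonneg _))
      have i3 := (iabs p M).mul_const (Z M)
      rw [intervalIntegral.abs_integral_eq_abs_integral_uIoc] at b1 b2 ⊢
      rw [intervalIntegrable_iff] at i1 i2 i3
      have n1 : 0 ≤ ∫ t in Set.uIoc p M, |y' t| := integral_nonneg fun t => abs_nonneg _
      have n2 : 0 ≤ ∫ t in Set.uIoc p M, |q' t| := integral_nonneg fun t => abs_nonneg _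
      rw [abs_of_nonneg n1] at b1
      rw [abs_of_nonneg n2] at b2
      refine le_trans ?_ (le_abs_self _)
      calc Z M ≤ _ := add_le_add b1 b2
        _ = ∫ t in Set.uIoc p M, (|y' t| + |q' t|) := (integral_add i1 i2).symm
        _ ≤ _ := setIntegral_mono_on_ae (i1.add i2) i3 measurableSet_uIoc key
    have hMball : M ∈ Metric.ball p ε :=
      Metric.closedBall_subset_ball (half_lt_self hε) hM
    have h12 := hball M hMball
    rw [intervalIntegral.integral_mul_const, abs_mul, abs_of_nonneg (Z0 M)] at hZM
    have hM0 : Z M ≤ 0 := by nlinarith [Z0 M]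
    exact le_antisymm ((hmax hz).trans hM0) (Z0 z)
  have hclosed : IsClosed {x | Z x = 0} := isClosed_eq Zc continuous_const
  have huniv := IsClopen.eq_univ ⟨hclosed, hopen⟩ ⟨x₀, (Zz x₀).2 ⟨hy₀, hq₀⟩⟩
  exact (Zz x).1 (huniv.symm ▸ Set.mem_univ x : x ∈ {x | Z x = 0})

/-! ### Behaviour at infinity -/

/-- Cauchy–Schwarz in additive form: |f'| ≤ t f'² + 1/(4t) is integrated, with t free to choose. -/
theorem IsPrimitive.uniformContinuous {f f' : ℝ → ℝ} (hf : IsPrimitive f f')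
    (h2 : MemLp f' 2 volume) : UniformContinuous f := by
  rw [Metric.uniformContinuous_iff]
  intro ε hε
  set N := ∫ x, f' x ^ 2 with hN
  have hN0 : 0 ≤ N := integral_nonneg fun x => sq_nonneg _
  -- This t makes t N ≤ ε/2; an interval shorter than 2tε then contributes less than ε/2 through the
  -- constant 1/(4t).
  set t := ε / (2 * (N + 1)) with ht
  have ht0 : 0 < t := by positivity
  refine ⟨2 * t * ε, by positivity, fun {a b} hab => ?_⟩
  rw [Real.dist_eq] at hab ⊢
  rw [← hf.integral_eq b a]
  have hsq := h2.integrable_sq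
  have hle : ‖∫ x in b..a, f' x‖ ≤ |∫ x in b..a, (t * f' x ^ 2 + 1 / (4 * t))| := by
    refine intervalIntegral.norm_integral_le_abs_of_norm_le (Eventually.of_forall fun x => ?_) ?_
    · rw [Real.norm_eq_abs, ← sub_nonneg]
      have : t * f' x ^ 2 + 1 / (4 * t) - |f' x| = t * (|f' x| - 1 / (2 * t)) ^ 2 := by
        rw [← sq_abs (f' x)]; field_simp; ring
      rw [this]; positivity
    · exact ((hsq.intervalIntegrable).const_mul t).add intervalIntegrable_const
  rw [Real.norm_eq_abs, intervalIntegral.integral_add (hsq.intervalIntegrable.const_mul t)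
    intervalIntegrable_const, intervalIntegral.integral_const_mul,
    intervalIntegral.integral_const, smul_eq_mul] at hle
  have hint : |∫ x in b..a, f' x ^ 2| ≤ N := by
    rw [intervalIntegral.abs_integral_eq_abs_integral_uIoc,
      abs_of_nonneg (integral_nonneg fun x => sq_nonneg _)]
    exact setIntegral_le_integral hsq (Eventually.of_forall fun x => sq_nonneg _)
  have h1 : |t * ∫ x in b..a, f' x ^ 2| ≤ t * N := by
    rw [abs_mul, abs_of_pos ht0]; gcongr
  have h3 : |(a - b) * (1 / (4 * t))| < ε / 2 := by
    rw [abs_mul, abs_of_pos (by positivity : 0 < 1 / (4 * t)), mul_one_div, div_lt_iff₀ (by positivity)]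
    linarith
  have h4 : t * N ≤ ε / 2 := by
    rw [ht, div_mul_eq_mul_div, div_le_div_iff₀ (by positivity) two_pos]
    nlinarith
  calc _ ≤ _ := hle
    _ ≤ _ := abs_add_le _ _
    _ < ε := by linarith

/-- If |m x| ≥ ε, uniform continuity keeps |m| ≥ ε/2 on [x, x + δ/2], so m² has mass at least
(δ/2)(ε/2)² there. Convergence of the integral of m² excludes this for large x. -/
theorem tendsto_atTop_zero_of_uniformContinuous_of_memLp {m : ℝ → ℝ} (hm : UniformContinuous m)
    (h2 : MemLp m 2 volume) : Tendsto m atTop (𝓝 0) := by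
  have hsq := h2.integrable_sq
  have ii : ∀ a b, IntervalIntegrable (fun x => m x ^ 2) volume a b := fun a b =>
    hsq.intervalIntegrable
  rw [Metric.tendsto_nhds]
  intro ε hε
  obtain ⟨δ, hδ, hmδ⟩ := Metric.uniformContinuous_iff.1 hm (ε / 2) (half_pos hε)
  have hF := intervalIntegral_tendsto_integral_Ioi 0 hsq.integrableOn tendsto_id
  have hF' := intervalIntegral_tendsto_integral_Ioi 0 hsq.integrableOn
    (tendsto_atTop_add_const_right atTop (δ / 2) tendsto_id)
  have hd := hF'.sub hF
  rw [sub_self] at hd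
  have hev := hd.eventually (gt_mem_nhds (by positivity : 0 < δ / 2 * (ε / 2) ^ 2))
  filter_upwards [hev] with x hx
  rw [intervalIntegral.integral_interval_sub_left (ii _ _) (ii _ _)] at hx
  by_contra! hc
  rw [dist_zero_right, Real.norm_eq_abs] at hc
  have hlow : ∫ y in x..(x + δ / 2), (ε / 2) ^ 2 ≤ ∫ y in x..(x + δ / 2), m y ^ 2 := by
    refine intervalIntegral.integral_mono_on (by linarith) intervalIntegrable_const (ii _ _)
      fun y hy => ?_
    have h1 : dist y x < δ := by
      rw [Real.dist_eq, abs_of_nonneg (by linarith [hy.1])]; linarith [hy.2]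
    have h3 := hmδ h1
    rw [Real.dist_eq] at h3
    have h4 : ε / 2 ≤ |m y| := by
      have := abs_sub_abs_le_abs_sub (m x) (m y)
      rw [abs_sub_comm] at this
      linarith
    rw [← sq_abs (m y)]
    gcongr
  rw [intervalIntegral.integral_const, smul_eq_mul] at hlow
  simp only [id] at hx
  linarith

theorem tendsto_cocompact_zero_of_uniformContinuous_of_memLp {m : ℝ → ℝ}
    (hm : UniformContinuous m) (h2 : MemLp m 2 volume) : Tendsto m (cocompact ℝ) (𝓝 0) := by
  rw [cocompact_eq_atBot_atTop, tendsto_sup]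
  refine ⟨?_, tendsto_atTop_zero_of_uniformContinuous_of_memLp hm h2⟩
  have h := tendsto_atTop_zero_of_uniformContinuous_of_memLp (m := fun x => m (-x))
    (hm.comp uniformContinuous_neg)
    (h2.comp_measurePreserving (Measure.measurePreserving_neg volume))
  simpa [Function.comp_def] using h.comp tendsto_neg_atBot_atTop

/-- A uniformly continuous function with `1 - ‖w‖ ^ 2 ∈ L²` satisfies `‖w‖ → 1` at infinity. -/
theorem tendsto_norm_cocompact_one {w : ℝ → ℂ} (hw : UniformContinuous w)
    (h2 : MemLp (fun x => 1 - ‖w x‖ ^ 2) 2 volume) :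
    Tendsto (fun x => ‖w x‖) (cocompact ℝ) (𝓝 1) := by
  have hn : UniformContinuous fun x => ‖w x‖ - 1 := by
    simpa using (uniformContinuous_norm.comp hw).sub (uniformContinuous_const (b := (1 : ℝ)))
  have hL : MemLp (fun x => ‖w x‖ - 1) 2 volume := by
    refine h2.mono hn.continuous.aestronglyMeasurable (Eventually.of_forall fun x => ?_)
    have h : 1 - ‖w x‖ ^ 2 = -((‖w x‖ - 1) * (‖w x‖ + 1)) := by ring
    rw [h, norm_neg, norm_mul]
    refine le_mul_of_one_le_right (norm_nonneg _) ?_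
    rw [Real.norm_of_nonneg (by positivity)]
    linarith [norm_nonneg (w x)]
  simpa using (tendsto_cocompact_zero_of_uniformContinuous_of_memLp hn hL).add_const 1

theorem exists_norm_le_of_tendsto_norm {w : ℝ → ℂ} (hw : Continuous w)
    (ht : Tendsto (fun x => ‖w x‖) (cocompact ℝ) (𝓝 1)) : ∃ M, ∀ x, ‖w x‖ ≤ M := by
  obtain ⟨K, hK, hKs⟩ := mem_cocompact.1 (ht.eventually (gt_mem_nhds (one_lt_two (α := ℝ))))
  obtain ⟨M, hM⟩ := hK.exists_bound_of_continuousOn hw.continuousOn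
  refine ⟨max M 2, fun x => ?_⟩
  by_cases hx : x ∈ K
  · exact (hM x hx).trans (le_max_left _ _)
  · exact (le_of_lt (hKs hx)).trans (le_max_right _ _)

theorem iInf_norm_pos_of_tendsto_norm {w : ℝ → ℂ} (hw : Continuous w)
    (ht : Tendsto (fun x => ‖w x‖) (cocompact ℝ) (𝓝 1)) (h0 : ∀ x, w x ≠ 0) :
    0 < ⨅ x : ℝ, ‖w x‖ := by
  obtain ⟨K, hK, hKs⟩ := mem_cocompact.1
    (ht.eventually (lt_mem_nhds (half_lt_self (one_pos (α := ℝ)))))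
  suffices h : ∃ m > 0, ∀ x, m ≤ ‖w x‖ by
    obtain ⟨m, hm, hmx⟩ := h
    exact hm.trans_le (le_ciInf hmx)
  rcases K.eq_empty_or_nonempty with rfl | hne
  · exact ⟨1 / 2, by norm_num, fun x => le_of_lt (hKs (Set.mem_compl (Set.notMem_empty x)))⟩
  · obtain ⟨z, -, hz⟩ := hK.exists_isMinOn hne hw.norm.continuousOn
    refine ⟨min ‖w z‖ (1 / 2), lt_min (norm_pos_iff.2 (h0 z)) (by norm_num), fun x => ?_⟩
    by_cases hx : x ∈ K
    · exact (min_le_left _ _).trans (hz hx)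
    · exact (min_le_right _ _).trans (le_of_lt (hKs hx))

/-! ### Real components of complex weak derivatives -/

theorem ContinuousLinearMap.locallyIntegrable_comp {u : ℝ → ℂ} (L : ℂ →L[ℝ] ℝ)
    (hu : LocallyIntegrable u volume) : LocallyIntegrable (fun x => L (u x)) volume := fun x => by
  obtain ⟨s, hs, hi⟩ := hu x
  exact ⟨s, hs, L.integrable_comp hi⟩

namespace QGP

theorem HasWeakDeriv.exists_isPrimitive {u v : ℝ → ℂ} (h : HasWeakDeriv u v) (L : ℂ →L[ℝ] ℝ) :
    ∃ w, IsPrimitive w (fun x => L (v x)) ∧ w =ᵐ[volume] fun x => L (u x) := by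
  obtain ⟨hu, hv, H⟩ := h
  refine _root_.exists_isPrimitive (L.locallyIntegrable_comp hu) (L.locallyIntegrable_comp hv)
    fun φ hφ hφc => ?_
  have h1 := congrArg L (H φ hφ hφc)
  have i1 : Integrable (fun x => deriv φ x • u x) volume :=
    hu.integrable_smul_left_of_hasCompactSupport (hφ.continuous_deriv (by simp)) hφc.deriv
  have i2 : Integrable (fun x => φ x • v x) volume :=
    hv.integrable_smul_left_of_hasCompactSupport hφ.continuous hφc
  rw [map_neg, ← L.integral_comp_comm i1, ← L.integral_comp_comm i2] at h1
  simpa only [map_smul, smul_eq_mul] using h1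

theorem HasWeakDeriv.ae_eq {u v v' : ℝ → ℂ} (h : HasWeakDeriv u v) (h' : HasWeakDeriv u v') :
    v =ᵐ[volume] v' :=
  ae_eq_of_integral_contDiff_smul_eq h.2.1 h'.2.1 fun φ hφ hφc =>
    neg_injective ((h.2.2 φ hφ hφc).symm.trans (h'.2.2 φ hφ hφc))

theorem HasWeakDeriv.congr_left {u u' v : ℝ → ℂ} (h : HasWeakDeriv u v)
    (hu : u =ᵐ[volume] u') : HasWeakDeriv u' v := by
  refine ⟨h.1.congr hu, h.2.1, fun φ hφ hφc => ?_⟩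
  rw [← h.2.2 φ hφ hφc]
  exact integral_congr_ae (hu.mono fun x hx => by simp only [hx])

theorem MemX.congr {u w : ℝ → ℂ} (h : MemX u) (hu : u =ᵐ[volume] w) : MemX w := by
  obtain ⟨⟨h1, v, h2, h3⟩, h4, v', h5, h6⟩ := h
  refine ⟨⟨fun K hK => (memLp_congr_ae (ae_restrict_of_ae hu)).1 (h1 K hK), v, h2,
    h3.congr_left hu⟩, (memLp_congr_ae ?_).1 h4, v', h5.congr_left hu, h6⟩
  exact hu.mono fun x hx => by simp only [hx]

end QGP

/-! ### The equation in flux form -/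

namespace QGP

/-- The flux `u' - 2κ⟨u, u'⟩u`, where `v` stands for `u'`. -/
def flux (κ : ℝ) (u v : ℝ → ℂ) (x : ℝ) : ℂ :=
  v x - (2 * κ * inner ℝ (u x) (v x)) • u x

/-- The source `icu' + u(1 - |u|²) + 2κ⟨u, u'⟩u'`, where `v` stands for `u'`. -/
def source (c κ : ℝ) (u v : ℝ → ℂ) (x : ℝ) : ℂ :=
  c • (Complex.I * v x) + (1 - ‖u x‖ ^ 2) • u x + (2 * κ * inner ℝ (u x) (v x)) • v x

theorem memLp_inner {w v : ℝ → ℂ} (hw : Continuous w) {M : ℝ} (hM : ∀ x, ‖w x‖ ≤ M)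
    (hv : MemLp v 2 volume) : MemLp (fun x => inner ℝ (w x) (v x)) 2 volume :=
  hv.of_le_mul (c := M) (hw.aestronglyMeasurable.inner hv.1) (Filter.Eventually.of_forall fun x =>
    (norm_inner_le_norm _ _).trans (mul_le_mul_of_nonneg_right (hM x) (norm_nonneg _)))

theorem locallyIntegrable_flux (κ : ℝ) {w v : ℝ → ℂ} (hw : Continuous w) {M : ℝ}
    (hM : ∀ x, ‖w x‖ ≤ M) (hv : MemLp v 2 volume) :
    LocallyIntegrable (flux κ w v) volume := by
  have hs := ((memLp_inner hw hM hv).locallyIntegrable one_le_two).smul (2 * κ)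
  exact (hv.locallyIntegrable one_le_two).sub (hs.smul_continuous hw)

/-- The term 2κ⟨w,v⟩v is a product of two L² functions, hence in L¹. -/
theorem locallyIntegrable_source (c κ : ℝ) {w v : ℝ → ℂ} (hw : Continuous w) {M : ℝ}
    (hM : ∀ x, ‖w x‖ ≤ M) (hv : MemLp v 2 volume) :
    LocallyIntegrable (source c κ w v) volume := by
  refine LocallyIntegrable.add (LocallyIntegrable.add ?_ ?_) ?_
  · exact ((hv.const_mul Complex.I).locallyIntegrable one_le_two).smul c
  · exact Continuous.locallyIntegrable (by fun_prop)
  · exact ((hv.smul ((memLp_inner hw hM hv).const_mul (2 * κ)) (r := 1)).locallyIntegrable le_rfl)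

/-- The flux of a weak solution has a representative whose derivative is minus the source. -/
theorem exists_isPrimitive_flux {c κ : ℝ} {u v w : ℝ → ℂ} (huw : w =ᵐ[volume] u)
    (hw : Continuous w) {M : ℝ} (hM : ∀ x, ‖w x‖ ≤ M) (hv : MemLp v 2 volume)
    (H : ∀ φ : ℝ → ℂ, ContDiff ℝ ∞ φ → HasCompactSupport φ →
      ∫ x, (inner ℝ (Complex.I * c * v x + u x * ((1 - ‖u x‖ ^ 2 : ℝ) : ℂ)) (φ x)
        - inner ℝ (v x) (deriv φ x)
        + 2 * κ * inner ℝ (u x) (v x)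
          * (inner ℝ (v x) (φ x) + inner ℝ (u x) (deriv φ x))) = 0) (e : ℂ) :
    ∃ p, IsPrimitive p (fun x => -inner ℝ e (source c κ w v x)) ∧
      p =ᵐ[volume] fun x => inner ℝ e (flux κ w v x) := by
  have hP : LocallyIntegrable (fun x => inner ℝ e (flux κ w v x)) volume :=
    (innerSL ℝ e).locallyIntegrable_comp (locallyIntegrable_flux κ hw hM hv)
  have hA : LocallyIntegrable (fun x => inner ℝ e (source c κ w v x)) volume :=
    (innerSL ℝ e).locallyIntegrable_comp (locallyIntegrable_source c κ hw hM hv)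
  refine exists_isPrimitive hP hA.neg fun ψ hψ hψc => ?_
  -- Testing with ψe, e constant, isolates the component of the equation along e.
  have h := H (fun x => ψ x • e) (hψ.smul contDiff_const) hψc.smul_right
  have dψ : ∀ x, deriv (fun x => ψ x • e) x = deriv ψ x • e := fun x =>
    deriv_smul_const ((hψ.differentiable (by simp)) x) e
  have i1 : Integrable (fun x => ψ x * inner ℝ e (source c κ w v x)) volume :=
    hA.integrable_smul_left_of_hasCompactSupport hψ.continuous hψc
  have i2 : Integrable (fun x => deriv ψ x * inner ℝ e (flux κ w v x)) volume :=
    hP.integrable_smul_left_of_hasCompactSupport (hψ.continuous_deriv (by simp)) hψc.deriv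
  have h' : ∫ x, (ψ x * inner ℝ e (source c κ w v x)
      - deriv ψ x * inner ℝ e (flux κ w v x)) = 0 := by
    rw [← h]
    refine integral_congr_ae (huw.mono fun x hx => ?_)
    simp only [dψ, ← hx, source, flux, inner_add_right, inner_sub_right, inner_smul_right,
      inner_add_left]
    rw [real_inner_comm e (v x), real_inner_comm e (w x),
      show Complex.I * c * v x = c • (Complex.I * v x) by
        rw [Complex.real_smul]; ring,
      show w x * ((1 - ‖w x‖ ^ 2 : ℝ) : ℂ) = (1 - ‖w x‖ ^ 2) • w x by
        rw [Complex.real_smul]; ring,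
      real_inner_smul_left, real_inner_smul_left, real_inner_comm e (w x),
      real_inner_comm e (Complex.I * v x)]
    ring
  rw [integral_sub i1 i2] at h'
  simp only [mul_neg, integral_neg, neg_neg]
  linarith

/-! ### Momentum identity and rigidity of stationary solutions -/

section Momentum

variable {c κ : ℝ} {w v : ℝ → ℂ} {p₁ p₂ : ℝ → ℝ}
  (h₁ : IsPrimitive (fun x => (w x).re) fun x => (v x).re)
  (h₂ : IsPrimitive (fun x => (w x).im) fun x => (v x).im)
  (hp₁ : IsPrimitive p₁ fun x => -(source c κ w v x).re)
  (hp₂ : IsPrimitive p₂ fun x => -(source c κ w v x).im)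
  (hf₁ : p₁ =ᵐ[volume] fun x => (flux κ w v x).re)
  (hf₂ : p₂ =ᵐ[volume] fun x => (flux κ w v x).im)

theorem inner_eq (z z' : ℂ) : inner ℝ z z' = z.re * z'.re + z.im * z'.im := by
  rw [Complex.inner]; simp [mul_comm]

theorem sq_norm_eq (z : ℂ) : ‖z‖ ^ 2 = z.re * z.re + z.im * z.im := by
  rw [Complex.sq_norm, Complex.normSq_apply]

include h₁ h₂ hp₁ hp₂ hf₁ hf₂ in
/-- The momentum identity `⟨iu, u'⟩ = (c/2)(1 - |u|²)`. -/
theorem momentum_eq {M : ℝ} (hM : ∀ x, ‖w x‖ ≤ M) (hv : MemLp v 2 volume)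
    (hη : MemLp (fun x => 1 - ‖w x‖ ^ 2) 2 volume) (x : ℝ) :
    (w x).re * p₂ x - (w x).im * p₁ x = c / 2 * (1 - ‖w x‖ ^ 2) := by
  -- The terms carrying κ cancel in the derivative of w × p, leaving -c⟨w,v⟩, which the derivative
  -- of (c/2)|w|² offsets.
  have hJ := ((h₁.mul hp₂).sub (h₂.mul hp₁)).add
    (((h₁.mul h₁).add (h₂.mul h₂)).const_mul (c / 2))
  have hz := hJ.eq_const_of_ae_zero (by
    filter_upwards [hf₁, hf₂] with t e1 e2
    rw [e1, e2]
    simp only [flux, source, inner_eq, Complex.sub_re, Complex.sub_im, Complex.add_re,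
      Complex.add_im, Complex.smul_re, Complex.smul_im, Complex.I_mul_re, Complex.I_mul_im,
      smul_eq_mul, Pi.zero_apply]
    ring)
  set K := (w 0).re * p₂ 0 - (w 0).im * p₁ 0
    + c / 2 * ((w 0).re * (w 0).re + (w 0).im * (w 0).im) - c / 2 with hK
  have hx : ∀ x, (w x).re * p₂ x - (w x).im * p₁ x - c / 2 * (1 - ‖w x‖ ^ 2) = K := fun x => by
    rw [sq_norm_eq, hK, ← hz x]; ring
  have cw : Continuous w := by
    have : w = fun x => ((w x).re : ℂ) + (w x).im * Complex.I :=
      funext fun x => (Complex.re_add_im _).symm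
    rw [this]
    have := h₁.continuous
    have := h₂.continuous
    fun_prop
  have hJ2 : MemLp (fun x => inner ℝ (Complex.I * w x) (v x)) 2 volume :=
    memLp_inner (by fun_prop) (M := M) (fun x => by simpa using hM x) hv
  -- Almost everywhere K = ⟨iw,v⟩ - (c/2)(1 - |w|²), a difference of L² functions; a constant in
  -- L²(ℝ) is zero.
  have hKL : MemLp (fun _ : ℝ => K) 2 volume := by
    refine (memLp_congr_ae ?_).1 (hJ2.sub (hη.const_mul (c / 2)))
    filter_upwards [hf₁, hf₂] with t e1 e2
    rw [← hx t, e1, e2]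
    simp only [flux, inner_eq, Pi.sub_apply, Complex.sub_re, Complex.sub_im, Complex.smul_re,
      Complex.smul_im, Complex.I_mul_re, Complex.I_mul_im, smul_eq_mul]
    ring
  rw [memLp_const_iff two_ne_zero ENNReal.ofNat_ne_top] at hKL
  have hK0 : K = 0 := by simpa using hKL
  linarith [hx x]

include h₁ h₂ hp₁ hp₂ hf₁ hf₂ in
/-- A stationary solution keeps the direction it has at a point where it is parallel
to its flux. -/
theorem parallel_of_speed_eq_zero (hc : c = 0) {M : ℝ} (hM : ∀ x, ‖w x‖ ≤ M)
    (hv : MemLp v 2 volume) {x₀ : ℝ} (h0 : (w x₀).re * p₂ x₀ - (w x₀).im * p₁ x₀ = 0) (x : ℝ) :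
    (w x₀).re * (w x).im - (w x₀).im * (w x).re = 0 := by
  have cw : Continuous w := by
    have : w = fun x => ((w x).re : ℂ) + (w x).im * Complex.I :=
      funext fun x => (Complex.re_add_im _).symm
    rw [this]
    have := h₁.continuous
    have := h₂.continuous
    fun_prop
  set a := (w x₀).re with ha
  set b := (w x₀).im with hb
  have hy := (h₂.const_mul a).sub (h₁.const_mul b)
  have hq := (hp₂.const_mul a).sub (hp₁.const_mul b)
  have hs := (memLp_inner cw hM hv).const_mul (2 * κ)
  -- With s = 2κ⟨w,v⟩ and η = 1 - |w|², the system is Y' = Q + sY, Q' = -ηY - s(Q + sY). The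
  -- coefficient 1 + |s| + |η| + s² dominates it, and s ∈ L² makes s² integrable.
  have hk : LocallyIntegrable (fun x => 1 + ‖2 * κ * inner ℝ (w x) (v x)‖ + |1 - ‖w x‖ ^ 2|
      + (2 * κ * inner ℝ (w x) (v x)) ^ 2) volume := by
    refine LocallyIntegrable.add (LocallyIntegrable.add (LocallyIntegrable.add ?_ ?_) ?_) ?_
    · exact locallyIntegrable_const _
    · exact hs.norm.locallyIntegrable one_le_two
    · exact Continuous.locallyIntegrable (by fun_prop)
    · exact hs.integrable_sq.locallyIntegrable
  refine (eq_zero_of_isPrimitive_of_abs_le hy hq hk ?_ (x₀ := x₀) (by simp [a, b, mul_comm])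
    h0 x).1
  filter_upwards [hf₁, hf₂] with t e1 e2
  set s := 2 * κ * inner ℝ (w t) (v t) with hs'
  set Y := a * (w t).im - b * (w t).re with hY
  set Q := a * p₂ t - b * p₁ t with hQ
  set η := 1 - ‖w t‖ ^ 2 with hη
  have d1 : a * (v t).im - b * (v t).re = Q + s * Y := by
    rw [hQ, hY, e1, e2]
    simp only [flux, Complex.sub_re, Complex.sub_im, Complex.smul_re, Complex.smul_im,
      smul_eq_mul, ← hs']
    ring
  have d2 : a * -(source c κ w v t).im - b * -(source c κ w v t).re
      = -(η * Y) - s * (Q + s * Y) := by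
    rw [← d1, hY]
    simp only [source, hc, zero_smul, zero_add, Complex.add_re, Complex.add_im, Complex.smul_re,
      Complex.smul_im, smul_eq_mul, ← hs', ← hη]
    ring
  rw [d1, d2, Real.norm_eq_abs]
  have t1 : |Q + s * Y| ≤ |Q| + |s| * |Y| := by
    rw [← abs_mul]; exact abs_add_le _ _
  have t2 : |-(η * Y) - s * (Q + s * Y)| ≤ |η| * |Y| + |s| * |Q + s * Y| := by
    rw [← abs_mul, ← abs_mul, ← abs_neg (η * Y)]; exact abs_sub _ _
  have t3 := mul_le_mul_of_nonneg_left t1 (abs_nonneg s)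
  rw [← sq_abs s]
  nlinarith [abs_nonneg s, abs_nonneg Q, abs_nonneg Y, abs_nonneg η,
    mul_nonneg (abs_nonneg η) (abs_nonneg Q), mul_nonneg (sq_nonneg |s|) (abs_nonneg Q)]

end Momentum

end QGP

end

/-! ### The two cases of the proposition -/

theorem proposition1p6 (c κ : ℝ) (hp : (c, κ) ∈ QGP.regionDtilde ∪ QGP.criticalC)
    (u : ℝ → ℂ) (hu : QGP.MemX u) (hsol : QGP.IsWeakSolution c κ u) :
    ∃ w : ℝ → ℂ, Continuous w ∧ w =ᵐ[volume] u ∧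
      (0 < c → QGP.MemNX w) ∧
      (c = 0 → ∃ ϕ : ℝ, ∀ x : ℝ, (Complex.exp (Complex.I * ϕ) * w x).im = 0) := by
  obtain ⟨-, v, -, hv, H⟩ := hsol
  have hv2 : MemLp v 2 volume := by
    obtain ⟨-, -, v', hv', hv'2⟩ := hu
    exact (memLp_congr_ae (hv'.ae_eq hv)).1 hv'2
  obtain ⟨w₁, h₁, e₁⟩ := hv.exists_isPrimitive Complex.reCLM
  obtain ⟨w₂, h₂, e₂⟩ := hv.exists_isPrimitive Complex.imCLM
  have uc₁ := h₁.uniformContinuous (Complex.reCLM.comp_memLp' hv2)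
  have uc₂ := h₂.uniformContinuous (Complex.imCLM.comp_memLp' hv2)
  obtain ⟨w, rfl, rfl⟩ : ∃ w : ℝ → ℂ, (fun x => (w x).re) = w₁ ∧ (fun x => (w x).im) = w₂ :=
    ⟨fun x => ⟨w₁ x, w₂ x⟩, rfl, rfl⟩
  have huw : w =ᵐ[volume] u := by
    filter_upwards [e₁, e₂] with x a1 a2
    exact Complex.ext a1 a2
  have uw : UniformContinuous w :=
    (Complex.equivRealProdCLM.symm : ℝ × ℝ →L[ℝ] ℂ).uniformContinuous.comp (uc₁.prodMk uc₂)
  have hX : QGP.MemX w := hu.congr huw.symm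
  have ht := tendsto_norm_cocompact_one uw hX.2.1
  obtain ⟨M, hM⟩ := exists_norm_le_of_tendsto_norm uw.continuous ht
  obtain ⟨p₁, hp₁, hf₁⟩ := QGP.exists_isPrimitive_flux huw uw.continuous hM hv2 H 1
  obtain ⟨p₂, hp₂, hf₂⟩ := QGP.exists_isPrimitive_flux huw uw.continuous hM hv2 H Complex.I
  simp only [QGP.inner_eq, Complex.one_re, Complex.one_im, Complex.I_re, Complex.I_im, one_mul,
    zero_mul, add_zero, zero_add] at hp₁ hf₁ hp₂ hf₂
  have hJ := QGP.momentum_eq h₁ h₂ hp₁ hp₂ hf₁ hf₂ hM hv2 hX.2.1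
  refine ⟨w, uw.continuous, huw, fun hc => ⟨hX, ?_⟩, fun hc => ?_⟩
  · refine iInf_norm_pos_of_tendsto_norm uw.continuous ht fun x hx => ?_
    have := hJ x
    simp only [hx, Complex.zero_re, Complex.zero_im, norm_zero] at this
    linarith
  · by_cases h0 : ∃ x₀, w x₀ ≠ 0
    · obtain ⟨x₀, hx₀⟩ := h0
      -- This rotation makes w x₀ a positive real, so every value parallel to it becomes real.
      refine ⟨-Complex.arg (w x₀), fun x => ?_⟩
      have hpar := QGP.parallel_of_speed_eq_zero h₁ h₂ hp₁ hp₂ hf₁ hf₂ hc hM hv2 (x₀ := x₀)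
        (by rw [hJ, hc]; ring) x
      rw [← Complex.norm_mul_cos_arg (w x₀), ← Complex.norm_mul_sin_arg (w x₀)] at hpar
      rw [mul_comm Complex.I, Complex.mul_im, Complex.exp_ofReal_mul_I_re,
        Complex.exp_ofReal_mul_I_im, Real.cos_neg, Real.sin_neg]
      refine mul_left_cancel₀ (norm_ne_zero_iff.2 hx₀) ?_
      linarith
    · push Not at h0
      exact ⟨0, fun x => by simp [h0 x]⟩
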